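/- Let $\mathcal F=\{A_1,\dots,A_m\}$, $m\ge 1$, be a finite family of real $d\times d$ matrices. Write $\rho$ for the spectral radius and, for a norm $\|\cdot\|$ on $\mathbb R^d$ with induced matrix norm, $$\check\rho(\mathcal F)=\lim_{k\to\infty}\ \min_{1\le i_1,\dots,i_k\le m}\|A_{i_1}\cdots A_{i_k}\|^{1/k}$$ for the lower spectral radius. Assume that $\mathcal F$ is asymptotically rank-one: for every product $P=A_{i_1}\cdots A_{i_k}$ with $k\ge1$, one has $\rho(P)>0$, one of $\pm\rho(P)$ is an (algebraically) simple eigenvalue of $P$, and all other complex eigenvalues of $P$ have modulus less than $\rho(P)$. Let $H_P\subset\mathbb R^d$ be the sum of the real generalized eigenspaces of $P$ (for a pair of conjugate non-real eigenvalues: the real vectors in the sum of their two generalized eigenspaces) belonging to all eigenvalues other than this leading one, and let $\mathcal H(\mathcal F)=\bigcup_P H_P$, the union over all products $P$ of degree $k\ge1$. Let $K\subset\mathbb R^d$ be a proper cone (nonempty, closed, convex, $\mathbb R_+K\subseteq K$, $K\cap-K=\{0\}$, $\mathrm{span}\,K=\mathbb R^d$) with $A_iK\subseteq K$ for all $i$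 and $$K\cap\mathrm{clos}(\mathcal H(\mathcal F))=\{0\}.$$ Fix $\delta>0$ and a positive antinorm $a$ on $K$, i.e. a continuous function $a:K\to[0,\infty)$ with $a(\lambda x)=\lambda a(x)$ for $\lambda\ge0$, $a(x+y)\ge a(x)+a(y)$, and $a(x)>0$ for $x\in K\setminus\{0\}$. For a matrix $M$ with $MK\subseteq K$ put $a(M)=\inf\{a(Mx):x\in K,\ a(x)=1\}$, and for $P=A_{i_1}\cdots A_{i_k}$ put $q(P)=\max_{1\le j\le k}a(A_{i_1}\cdots A_{i_j})^{1/j}$. Let $S_1=\mathcal F$, $t_1=\min_i a(A_i)$, $s_1=\min_i\rho(A_i)$ and, for $k>1$, $$S_k=\{P=A_{i_1}\cdots A_{i_k}:\ A_{i_1}\cdots A_{i_{k-1}}\in S_{k-1},\ q(P)<s_{k-1}-\delta\},$$ $$s_k=\min\Big\{s_{k-1},\min_{P\in S_k}\rho(P)^{1/k}\Big\},\qquad t_k=\max\Big\{t_{k-1},\min\big\{s_k-\delta,\min_{P\in S_k}q(P)\big\}\Big\},$$ where products are understood together with their factorization and a minimum over the empty set is $+\infty$. Then the limit defining $\check\rho(\mathcal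 F)$ exists, and $$t_k\le\check\rho(\mathcal F)\le s_k\qquad\text{for every }k\ge1.$$ Moreover $s_k-t_k$ converges to a limit that is at most $\delta$. If $s_k-t_k\ge\delta$ for every $k\ge 1$, then $$\lim_{k\to\infty}(s_k-t_k)=\delta.$$ Otherwise the accuracy $\delta$ is exceeded at some step and the procedure has then terminated: if $s_n-t_n<\delta$ for some $n\ge1$, then $S_k=\emptyset$, $t_k=t_n$ and $s_k=s_n$ for all $k>n$. -/

import Mathlib

open Filter Topology

noncomputable section

namespace LowerSpectralRadius

/-- The spectral radius of a real square matrix: the largest modulus of a complex eigenvalue. -/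
def specRad {d : ℕ} (M : Matrix (Fin d) (Fin d) ℝ) : ℝ :=
  (spectralRadius ℂ (M.map Complex.ofReal)).toReal

/-! ### Products of a finite family and the lower spectral radius -/

/-- The product `A (i₁) * ⋯ * A (i_k)` attached to a word `[i₁, …, i_k]`. The set of all products
of degree `k` is the set of the `wordProd A w` with `w.length = k`. -/
def wordProd {d m : ℕ} (A : Fin m → Matrix (Fin d) (Fin d) ℝ) (w : List (Fin m)) :
    Matrix (Fin d) (Fin d) ℝ :=
  (w.map A).prod

/-- `N` is a norm on `ℝ^d` (a seminorm that vanishes only at the origin). -/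
def IsNorm {d : ℕ} (N : Seminorm ℝ (Fin d → ℝ)) : Prop :=
  ∀ x, N x = 0 → x = 0

/-- The matrix norm induced by `N`. -/
def inducedNorm {d : ℕ} (N : Seminorm ℝ (Fin d → ℝ)) (M : Matrix (Fin d) (Fin d) ℝ) : ℝ :=
  sSup {r | ∃ x : Fin d → ℝ, N x ≤ 1 ∧ r = N (M.mulVec x)}

/-- `min ‖P‖ ^ (1 / k)` over all products `P` of degree `k`. -/
def minNormRoot {d m : ℕ} (N : Seminorm ℝ (Fin d → ℝ))
    (A : Fin m → Matrix (Fin d) (Fin d) ℝ) (k : ℕ) : ℝ :=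
  sInf {r | ∃ w : List (Fin m), w.length = k ∧
    r = inducedNorm N (wordProd A w) ^ ((1 : ℝ) / (k : ℝ))}

/-- The lower spectral radius `lim_k min_{P of degree k} ‖P‖ ^ (1 / k)`. -/
def lsr {d m : ℕ} (N : Seminorm ℝ (Fin d → ℝ)) (A : Fin m → Matrix (Fin d) (Fin d) ℝ) : ℝ :=
  limUnder atTop (minNormRoot N A)

/-! ### Cones -/

/-- A proper cone: nonempty, closed, convex, positively homogeneous, salient and solid. -/
structure IsProperCone {d : ℕ} (K : Set (Fin d → ℝ)) : Prop where
  nonempty : K.Nonempty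
  isClosed : IsClosed K
  convex : Convex ℝ K
  smul_mem : ∀ c : ℝ, 0 ≤ c → ∀ x ∈ K, c • x ∈ K
  salient : K ∩ -K = {0}
  solid : Submodule.span ℝ K = ⊤

/-- `K` is an invariant cone for the family `A`. -/
def IsInvariantCone {d m : ℕ} (K : Set (Fin d → ℝ))
    (A : Fin m → Matrix (Fin d) (Fin d) ℝ) : Prop :=
  IsProperCone K ∧ ∀ i, ∀ x ∈ K, (A i).mulVec x ∈ K

/-! ### Asymptotically rank-one families and their secondary set -/

/-- `M` is asymptotically rank-one: `ρ(M) > 0`, one of `ρ(M)`, `-ρ(M)` is a simple eigenvalue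
(a root of multiplicity one of the characteristic polynomial), and every other complex eigenvalue
has modulus less than `ρ(M)`. -/
def AsymptRankOne {d : ℕ} (M : Matrix (Fin d) (Fin d) ℝ) : Prop :=
  0 < specRad M ∧ ∃ lam : ℝ, (lam = specRad M ∨ lam = -specRad M) ∧
    M.charpoly.rootMultiplicity lam = 1 ∧
    ∀ z ∈ spectrum ℂ (M.map Complex.ofReal), z ≠ (lam : ℂ) → ‖z‖ < specRad M

/-- A family is asymptotically rank-one if all products of degree at least one are. -/
def AsymptRankOneFamily {d m : ℕ} (A : Fin m → Matrix (Fin d) (Fin d) ℝ) : Prop :=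
  ∀ w : List (Fin m), w ≠ [] → AsymptRankOne (wordProd A w)

/-- The inclusion of `ℝ^d` in `ℂ^d`, as a real linear map. -/
def complexify (d : ℕ) : (Fin d → ℝ) →ₗ[ℝ] (Fin d → ℂ) :=
  LinearMap.pi fun i => Complex.ofRealLI.toLinearMap ∘ₗ LinearMap.proj i

/-- The complex generalized eigenspace of a real matrix at `μ ∈ ℂ`
(trivial if `μ` is not an eigenvalue). -/
def genEigC {d : ℕ} (M : Matrix (Fin d) (Fin d) ℝ) (μ : ℂ) : Submodule ℂ (Fin d → ℂ) :=
  Module.End.maxGenEigenspace (Matrix.toLin' (M.map Complex.ofReal)) μ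

/-- `W_λ`: the real vectors in the generalized eigenspace of the real number `lam`. -/
def realGenEig {d : ℕ} (M : Matrix (Fin d) (Fin d) ℝ) (lam : ℝ) : Submodule ℝ (Fin d → ℝ) :=
  ((genEigC M (lam : ℂ)).restrictScalars ℝ).comap (complexify d)

/-- `U_ℝ(μ, μ̄)`: the real vectors in the sum of the generalized eigenspaces of `μ` and its
conjugate. -/
def pairGenEig {d : ℕ} (M : Matrix (Fin d) (Fin d) ℝ) (μ : ℂ) : Submodule ℝ (Fin d → ℝ) :=
  ((genEigC M μ ⊔ genEigC M (starRingEnd ℂ μ)).restrictScalars ℝ).comap (complexify d)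

/-- The secondary space `H_M` of an asymptotically rank-one matrix `M`: the sum of all `W_λ` and
`U_ℝ(μ, μ̄)` belonging to eigenvalues other than the leading one. For such a matrix these are the
eigenvalues of modulus less than `ρ(M)`. -/
def secondarySpace {d : ℕ} (M : Matrix (Fin d) (Fin d) ℝ) : Submodule ℝ (Fin d → ℝ) :=
  (⨆ (lam : ℝ) (_ : |lam| < specRad M), realGenEig M lam) ⊔
    (⨆ (μ : ℂ) (_ : μ.im ≠ 0 ∧ ‖μ‖ < specRad M), pairGenEig M μ)

/-- The secondary set of a family: the union of `H_P` over all products `P` of degree `≥ 1`. -/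
def secondarySet {d m : ℕ} (A : Fin m → Matrix (Fin d) (Fin d) ℝ) : Set (Fin d → ℝ) :=
  ⋃ (w : List (Fin m)) (_ : w ≠ []), (secondarySpace (wordProd A w) : Set (Fin d → ℝ))

/-! ### Antinorms -/

/-- `a` is an antinorm on `K` (only its values on `K` matter). -/
structure IsAntinorm {d : ℕ} (K : Set (Fin d → ℝ)) (a : (Fin d → ℝ) → ℝ) : Prop where
  continuousOn : ContinuousOn a K
  nontrivial : ∃ x ∈ K, a x ≠ 0
  nonneg : ∀ x ∈ K, 0 ≤ a x
  smul : ∀ c : ℝ, 0 ≤ c → ∀ x ∈ K, a (c • x) = c * a x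
  superadd : ∀ x ∈ K, ∀ y ∈ K, a x + a y ≤ a (x + y)

/-- `a` is a positive antinorm on `K`. -/
def IsPositiveAntinorm {d : ℕ} (K : Set (Fin d → ℝ)) (a : (Fin d → ℝ) → ℝ) : Prop :=
  IsAntinorm K a ∧ ∀ x ∈ K, x ≠ 0 → 0 < a x

/-- The operator antinorm `a(M) = inf {a (M x) : x ∈ K, a x = 1}`. -/
def opAntinorm {d : ℕ} (K : Set (Fin d → ℝ)) (a : (Fin d → ℝ) → ℝ)
    (M : Matrix (Fin d) (Fin d) ℝ) : ℝ :=
  sInf {r | ∃ x ∈ K, a x = 1 ∧ r = a (M.mulVec x)}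

/-! ### The Gripenberg-like bounds -/

/-- `q(P) = max_{1 ≤ j ≤ k} a(A (i₁) ⋯ A (i_j)) ^ (1 / j)` for the word `w = [i₁, …, i_k]`. -/
def qVal {d m : ℕ} (A : Fin m → Matrix (Fin d) (Fin d) ℝ) (K : Set (Fin d → ℝ))
    (a : (Fin d → ℝ) → ℝ) (w : List (Fin m)) : ℝ :=
  sSup ((fun j : ℕ => opAntinorm K a (wordProd A (w.take j)) ^ ((1 : ℝ) / (j : ℝ))) ''
    Set.Icc 1 w.length)

/-- What the method stores after a step: the set `S` of products that are kept (each as the word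
it is built from), the lower bound `t` and the upper bound `s`. -/
structure Stage (m : ℕ) where
  S : Set (List (Fin m))
  t : ℝ
  s : ℝ

/-- The first stage: `S₁` is the whole family, `t₁ = min a(A_i)` and `s₁ = min ρ(A_i)`. -/
def firstStage {d m : ℕ} (A : Fin m → Matrix (Fin d) (Fin d) ℝ) (K : Set (Fin d → ℝ))
    (a : (Fin d → ℝ) → ℝ) : Stage m where
  S := {w | ∃ i, w = [i]}
  t := ⨅ i, opAntinorm K a (A i)
  s := ⨅ i, specRad (A i)

/-- `S_k`: one-letter extensions `P` of elements of `S_{k-1}` with `q(P) < s_{k-1} - δ`. -/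
def nextSet {d m : ℕ} (A : Fin m → Matrix (Fin d) (Fin d) ℝ) (K : Set (Fin d → ℝ))
    (a : (Fin d → ℝ) → ℝ) (δ : ℝ) (p : Stage m) : Set (List (Fin m)) :=
  {w | ∃ v ∈ p.S, ∃ i, w = v ++ [i] ∧ qVal A K a w < p.s - δ}

/-- `s_k = min {s_{k-1}, min_{P ∈ S_k} ρ(P) ^ (1 / k)}`. All sets here are finite; an empty `S_k`
contributes nothing to the minimum (that is, a minimum over the empty set is `+∞`). -/
def nextUpper {d m : ℕ} (A : Fin m → Matrix (Fin d) (Fin d) ℝ) (K : Set (Fin d → ℝ))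
    (a : (Fin d → ℝ) → ℝ) (δ : ℝ) (k : ℕ) (p : Stage m) : ℝ :=
  sInf (insert p.s
    ((fun w => specRad (wordProd A w) ^ ((1 : ℝ) / (k : ℝ))) '' nextSet A K a δ p))

/-- `t_k = max {t_{k-1}, min {s_k - δ, min_{P ∈ S_k} q(P)}}`, with the same convention. -/
def nextLower {d m : ℕ} (A : Fin m → Matrix (Fin d) (Fin d) ℝ) (K : Set (Fin d → ℝ))
    (a : (Fin d → ℝ) → ℝ) (δ : ℝ) (k : ℕ) (p : Stage m) : ℝ :=
  max p.t (sInf (insert (nextUpper A K a δ k p - δ) (qVal A K a '' nextSet A K a δ p)))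

/-- `stage A K a δ n` is the stage of degree `n + 1`. -/
def stage {d m : ℕ} (A : Fin m → Matrix (Fin d) (Fin d) ℝ) (K : Set (Fin d → ℝ))
    (a : (Fin d → ℝ) → ℝ) (δ : ℝ) : ℕ → Stage m
  | 0 => firstStage A K a
  | n + 1 =>
    { S := nextSet A K a δ (stage A K a δ n)
      t := nextLower A K a δ (n + 2) (stage A K a δ n)
      s := nextUpper A K a δ (n + 2) (stage A K a δ n) }

/-- The set `S_k`, for `k ≥ 1`. -/
def prunedSet {d m : ℕ} (A : Fin m → Matrix (Fin d) (Fin d) ℝ) (K : Set (Fin d → ℝ))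
    (a : (Fin d → ℝ) → ℝ) (δ : ℝ) (k : ℕ) : Set (List (Fin m)) :=
  (stage A K a δ (k - 1)).S

/-- The lower bound `t_k`, for `k ≥ 1`. -/
def lowerBound {d m : ℕ} (A : Fin m → Matrix (Fin d) (Fin d) ℝ) (K : Set (Fin d → ℝ))
    (a : (Fin d → ℝ) → ℝ) (δ : ℝ) (k : ℕ) : ℝ :=
  (stage A K a δ (k - 1)).t

/-- The upper bound `s_k`, for `k ≥ 1`. -/
def upperBound {d m : ℕ} (A : Fin m → Matrix (Fin d) (Fin d) ℝ) (K : Set (Fin d → ℝ))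
    (a : (Fin d → ℝ) → ℝ) (δ : ℝ) (k : ℕ) : ℝ :=
  (stage A K a δ (k - 1)).s

end LowerSpectralRadius

end

/-! The heart is a converse estimate, `c * ρ(P) ≤ a(P)` with one `c > 0` for all products `P`. The
secondary space of `P` contains the kernel of a left eigenvector `f` for the leading eigenvalue. By
compactness the cone keeps a distance proportional to `‖x‖` from all these hyperplanes at once, so
`|f x|` is comparable to `‖f‖ ‖x‖` on `K`, uniformly in `P`. As `P` multiplies `|f|` by `ρ(P)`, it
expands every vector of `K` by at least a constant times `ρ(P)`
(`exists_mul_specRad_le_opAntinorm`).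

Let `s` be the limit of the decreasing `s_k`. A product `P` kept at degree `k` has `q(P) ≥
a(P)^(1/k) ≥ c^(1/k) * s`, which tends to `s`, yet it was kept because `q(P) < s_{k-1} - δ`. Hence
`S_k` is empty for all large `k` (`eventually_stage_eq_empty`), and then `t_k ≥ s_k - δ`.

The bound `s_k` comes from Gelfand's formula applied to powers of a product. The bound `t_k` comes
from supermultiplicativity of the operator antinorm: a long word is cut into bounded blocks that
each grow at rate `t_k`, up to a short tail (`le_lsr_of_prefix`). Existence of the limit is Fekete's
lemma, with the exponential lower bound supplied again by the converse estimate. Once the gap is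
below `δ`, monotonicity of `q` along prefixes leaves nothing to extend. -/

namespace LowerSpectralRadius

/-! ### Leading left eigenvectors and the secondary space. -/

section Spectral

variable {d : ℕ}

@[simp]
lemma complexify_apply (x : Fin d → ℝ) (i : Fin d) : complexify d x i = (x i : ℂ) := rfl

/-- The entrywise real part, as a real linear map. -/
noncomputable def realPart (d : ℕ) : (Fin d → ℂ) →ₗ[ℝ] (Fin d → ℝ) :=
  LinearMap.pi fun i => Complex.reLm ∘ₗ LinearMap.proj i

@[simp]
lemma realPart_apply (y : Fin d → ℂ) (i : Fin d) : realPart d y i = (y i).re := rfl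

lemma realPart_complexify (x : Fin d → ℝ) : realPart d (complexify d x) = x := by
  ext i; simp

lemma complexify_realPart (y : Fin d → ℂ) :
    complexify d (realPart d y) = (1 / 2 : ℂ) • (y + star y) := by
  ext i
  simp [Complex.re_eq_add_conj]
  ring

lemma toLin'_complexify (M : Matrix (Fin d) (Fin d) ℝ) (z : Fin d → ℝ) :
    Matrix.toLin' (M.map Complex.ofReal) (complexify d z) = complexify d (M.mulVec z) := by
  ext j
  simp [Matrix.mulVec, dotProduct]

lemma star_mem_genEigC (M : Matrix (Fin d) (Fin d) ℝ) {μ : ℂ} {y : Fin d → ℂ}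
    (hy : y ∈ genEigC M μ) : star y ∈ genEigC M (starRingEnd ℂ μ) := by
  unfold genEigC at *
  rw [Module.End.mem_maxGenEigenspace] at *
  obtain ⟨k, hk⟩ := hy
  refine ⟨k, ?_⟩
  have key : ∀ z : Fin d → ℂ,
      (Matrix.toLin' (M.map Complex.ofReal) - starRingEnd ℂ μ • 1) (star z)
        = star ((Matrix.toLin' (M.map Complex.ofReal) - μ • 1) z) := by
    intro z
    ext i
    simp [Matrix.mulVec, dotProduct]
  have : ∀ n : ℕ, ∀ z : Fin d → ℂ,
      ((Matrix.toLin' (M.map Complex.ofReal) - starRingEnd ℂ μ • 1) ^ n) (star z)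
        = star (((Matrix.toLin' (M.map Complex.ofReal) - μ • 1) ^ n) z) := by
    intro n
    induction n with
    | zero => intro z; simp
    | succ n ih => intro z; rw [pow_succ, pow_succ, Module.End.mul_apply, key, ih]; rfl
  rw [this, hk, star_zero]

/-- The real part is half the sum of `y` and its conjugate, and conjugation swaps the generalized
eigenspaces of `μ` and its conjugate. Real and non-real `μ` are separated because `secondarySpace`
treats them by different summands. -/
lemma realPart_mem_secondarySpace (M : Matrix (Fin d) (Fin d) ℝ) {μ : ℂ} {y : Fin d → ℂ}
    (hμ : ‖μ‖ < specRad M) (hy : y ∈ genEigC M μ) : realPart d y ∈ secondarySpace M := by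
  have hy' := star_mem_genEigC M hy
  by_cases him : μ.im = 0
  · obtain ⟨r, rfl⟩ : ∃ r : ℝ, μ = r := ⟨μ.re, by apply Complex.ext <;> simp [him]⟩
    rw [Complex.conj_ofReal] at hy'
    refine Submodule.mem_sup_left (Submodule.mem_iSup_of_mem r (Submodule.mem_iSup_of_mem ?_ ?_))
    · simpa using hμ
    · change complexify d (realPart d y) ∈ genEigC M r
      rw [complexify_realPart]
      exact Submodule.smul_mem _ _ (Submodule.add_mem _ hy hy')
  · refine Submodule.mem_sup_right
      (Submodule.mem_iSup_of_mem μ (Submodule.mem_iSup_of_mem ⟨him, hμ⟩ ?_))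
    change complexify d (realPart d y) ∈ genEigC M μ ⊔ genEigC M (starRingEnd ℂ μ)
    rw [complexify_realPart]
    exact Submodule.smul_mem _ _
      (Submodule.add_mem _ (Submodule.mem_sup_left hy) (Submodule.mem_sup_right hy'))

/-- If `μ` is not an eigenvalue, `T` is injective, hence so are its powers. This makes the modulus
bound in `AsymptRankOne`, which concerns the spectrum only, applicable to nonzero generalized
eigenvectors. -/
lemma mem_spectrum_of_mem_genEigC (M : Matrix (Fin d) (Fin d) ℝ) {μ : ℂ} {y : Fin d → ℂ}
    (hy : y ∈ genEigC M μ) (hy0 : y ≠ 0) : μ ∈ spectrum ℂ (M.map Complex.ofReal) := by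
  rw [← Matrix.spectrum_toLin', ← Module.End.hasEigenvalue_iff_mem_spectrum]
  by_contra hne
  have hbot : Module.End.eigenspace (Matrix.toLin' (M.map Complex.ofReal)) μ = ⊥ := by
    by_contra h
    exact hne h
  obtain ⟨k, hk⟩ := (Module.End.mem_maxGenEigenspace _ _ _).1 hy
  set T : Module.End ℂ (Fin d → ℂ) := Matrix.toLin' (M.map Complex.ofReal) - μ • 1 with hT
  have hinj : Function.Injective T := by
    rw [← LinearMap.ker_eq_bot, ← hbot, Module.End.eigenspace_def]
  have hinj' : Function.Injective (T ^ k) := by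
    rw [Module.End.coe_pow]; exact hinj.iterate k
  exact hy0 (hinj' (hk.trans (map_zero (T ^ k)).symm))

/-- Composing a left eigenvector for `lam` with the `k`-th power of `T - μ` multiplies it by `(lam -
μ) ^ k`, which is nonzero. -/
lemma apply_eq_zero_of_mem_genEigC (M : Matrix (Fin d) (Fin d) ℝ) {lam μ : ℂ} (hne : μ ≠ lam)
    (F : (Fin d → ℂ) →ₗ[ℂ] ℂ)
    (hF : ∀ y, F (Matrix.toLin' (M.map Complex.ofReal) y) = lam * F y) {y : Fin d → ℂ}
    (hy : y ∈ genEigC M μ) : F y = 0 := by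
  obtain ⟨k, hk⟩ := (Module.End.mem_maxGenEigenspace _ _ _).1 hy
  have : ∀ n : ℕ, ∀ z, F (((Matrix.toLin' (M.map Complex.ofReal) - μ • 1) ^ n) z)
      = (lam - μ) ^ n * F z := by
    intro n
    induction n with
    | zero => simp
    | succ n ih =>
      intro z
      rw [pow_succ, Module.End.mul_apply, ih]
      simp only [LinearMap.sub_apply, map_sub, hF, LinearMap.smul_apply, Module.End.one_apply,
        map_smul, smul_eq_mul]
      ring
  have h := this k y
  rw [hk, map_zero] at h
  exact (mul_eq_zero.1 h.symm).resolve_left (pow_ne_zero _ (sub_ne_zero.2 hne.symm))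

lemma exists_left_eigenvector (M : Matrix (Fin d) (Fin d) ℝ) {lam : ℝ}
    (h : M.charpoly.IsRoot lam) :
    ∃ f : Fin d → ℝ, f ≠ 0 ∧ ∀ x, f ⬝ᵥ M.mulVec x = lam * (f ⬝ᵥ x) := by
  rw [Polynomial.IsRoot, Matrix.eval_charpoly] at h
  obtain ⟨f, hf, hfM⟩ := Matrix.exists_vecMul_eq_zero_iff.2 h
  refine ⟨f, hf, fun x => ?_⟩
  rw [Matrix.vecMul_sub, sub_eq_zero] at hfM
  rw [Matrix.dotProduct_mulVec, ← hfM]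
  simp [Matrix.scalar_apply, dotProduct, Finset.mul_sum, mul_assoc, mul_left_comm]

lemma finrank_genEigC (M : Matrix (Fin d) (Fin d) ℝ) (lam : ℝ) :
    Module.finrank ℂ (genEigC M lam) = M.charpoly.rootMultiplicity lam := by
  unfold genEigC
  rw [LinearMap.finrank_maxGenEigenspace_eq, Matrix.charpoly_toLin',
    Polynomial.eq_rootMultiplicity_map (f := Complex.ofRealHom) Complex.ofRealHom.injective]
  erw [← Matrix.charpoly_map]
  rfl

/-- An asymptotically rank-one matrix has a left eigenvector for its leading eigenvalue, and the
kernel of this functional is contained in the secondary space. -/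
lemma AsymptRankOne.exists_functional {M : Matrix (Fin d) (Fin d) ℝ} (hM : AsymptRankOne M) :
    ∃ f : Fin d → ℝ, f ≠ 0 ∧ (∀ x, |f ⬝ᵥ M.mulVec x| = specRad M * |f ⬝ᵥ x|) ∧
      ∀ x, f ⬝ᵥ x = 0 → x ∈ secondarySpace M := by
  obtain ⟨hpos, lam, hlam, hmult, hlt⟩ := hM
  have hroot : M.charpoly.IsRoot lam := by
    by_contra h
    rw [Polynomial.rootMultiplicity_eq_zero h] at hmult
    omega
  obtain ⟨f, hf0, hf⟩ := exists_left_eigenvector M hroot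
  have habs : |lam| = specRad M := by
    rcases hlam with h | h <;> simp [h, abs_of_pos hpos]
  refine ⟨f, hf0, fun x => by rw [hf, abs_mul, habs], fun x hx => ?_⟩
  let F : (Fin d → ℂ) →ₗ[ℂ] ℂ := dotProductBilin ℂ ℂ (complexify d f)
  have hFapp : ∀ y, F y = complexify d f ⬝ᵥ y := fun y => rfl
  have hFreal : ∀ z : Fin d → ℝ, F (complexify d z) = ((f ⬝ᵥ z : ℝ) : ℂ) := by
    intro z
    simp [hFapp, dotProduct]
  have hFeq : F ∘ₗ Matrix.toLin' (M.map Complex.ofReal) = (lam : ℂ) • F := by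
    refine LinearMap.pi_ext' fun i => LinearMap.ext_ring ?_
    have h1 : (Pi.single i 1 : Fin d → ℂ) = complexify d (Pi.single i 1) := by
      ext j
      by_cases hj : j = i
      · subst hj; simp
      · simp [hj]
    have h2 : Matrix.toLin' (M.map Complex.ofReal) (complexify d (Pi.single i 1))
        = complexify d (M.mulVec (Pi.single i 1)) := toLin'_complexify M _
    simp only [LinearMap.comp_apply, LinearMap.single_apply, LinearMap.smul_apply, h1, h2, hFreal,
      hf]
    simp
  have hF : ∀ y, F (Matrix.toLin' (M.map Complex.ofReal) y) = lam * F y := fun y =>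
    LinearMap.congr_fun hFeq y
  have hF0 : F ≠ 0 := by
    intro h
    refine hf0 (funext fun i => ?_)
    have := hFreal (Pi.single i 1)
    rw [h] at this
    simpa using this.symm
  set W : Submodule ℂ (Fin d → ℂ) := ⨆ (μ : ℂ) (_ : μ ≠ lam), genEigC M μ with hW
  have htop : W ⊔ genEigC M lam = ⊤ := by
    rw [eq_top_iff, ← Module.End.iSup_maxGenEigenspace_eq_top
      (Matrix.toLin' (M.map Complex.ofReal))]
    refine iSup_le fun μ => ?_
    by_cases hμ : μ = lam
    · subst hμ; exact le_sup_right
    · exact le_sup_of_le_left (le_iSup₂_of_le μ hμ le_rfl)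
  have hFW : W ≤ LinearMap.ker F := iSup₂_le fun μ hμ y hy =>
    apply_eq_zero_of_mem_genEigC M hμ F hF hy
  -- Simplicity enters here: the leading generalized eigenspace is spanned by `v`. Since `F` already
  -- vanishes on `W`, it cannot vanish at `v` as well, so its kernel is exactly `W`.
  obtain ⟨v, hv⟩ := (finrank_le_one_iff (K := ℂ) (V := genEigC M lam)).1
    (by rw [finrank_genEigC, hmult])
  have hFv : F v ≠ 0 := by
    intro h
    refine hF0 (LinearMap.ker_eq_top.1 (eq_top_iff.2 (htop ▸ sup_le hFW fun y hy => ?_)))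
    obtain ⟨c, hc⟩ := hv ⟨y, hy⟩
    have : y = c • (v : Fin d → ℂ) := (congrArg Subtype.val hc).symm
    rw [LinearMap.mem_ker, this, map_smul, h, smul_zero]
  have hxW : complexify d x ∈ W := by
    obtain ⟨w, hw, u, hu, hwu⟩ := Submodule.mem_sup.1
      (htop ▸ Submodule.mem_top : complexify d x ∈ W ⊔ genEigC M lam)
    obtain ⟨c, hc⟩ := hv ⟨u, hu⟩
    have huv : u = c • (v : Fin d → ℂ) := (congrArg Subtype.val hc).symm
    have h0 : F (complexify d x) = 0 := by rw [hFreal, hx, Complex.ofReal_zero]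
    have hFw : F w = 0 := hFW hw
    rw [← hwu, map_add, hFw, zero_add, huv, map_smul, smul_eq_mul] at h0
    have hc0 : c = 0 := (mul_eq_zero.1 h0).resolve_right hFv
    rw [← hwu, huv, hc0, zero_smul, add_zero]
    exact hw
  have hWsec : ∀ y ∈ W, realPart d y ∈ secondarySpace M := by
    intro y hy
    rw [hW, iSup_subtype'] at hy
    refine Submodule.iSup_induction (fun μ : {μ : ℂ // μ ≠ lam} => genEigC M μ)
      (motive := fun y => realPart d y ∈ secondarySpace M) hy ?_ ?_ ?_
    · rintro ⟨μ, hμ⟩ z hz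
      by_cases hz0 : z = 0
      · rw [hz0, map_zero]; exact Submodule.zero_mem _
      · exact realPart_mem_secondarySpace M (hlt μ (mem_spectrum_of_mem_genEigC M hz hz0) hμ) hz
    · rw [map_zero]; exact Submodule.zero_mem _
    · intro y z hy hz
      rw [map_add]; exact Submodule.add_mem _ hy hz
  simpa [realPart_complexify] using hWsec _ hxW

end Spectral

/-! ### Comparison of homogeneous functions with the norm, induced norms, Gelfand's formula. -/

section Norms

variable {d m : ℕ}

lemma exists_pos_le_on_sphere {K : Set (Fin d → ℝ)} (hK : IsClosed K) {g : (Fin d → ℝ) → ℝ}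
    (hg : ContinuousOn g K) (hpos : ∀ x ∈ K, x ≠ 0 → 0 < g x) :
    ∃ c > 0, ∃ C > 0, ∀ x ∈ K, ‖x‖ = 1 → c ≤ g x ∧ g x ≤ C := by
  have hcomp : IsCompact (K ∩ Metric.sphere 0 1) := (isCompact_sphere 0 1).inter_left hK
  have hcont : ContinuousOn g (K ∩ Metric.sphere 0 1) := hg.mono Set.inter_subset_left
  rcases (K ∩ Metric.sphere (0 : Fin d → ℝ) 1).eq_empty_or_nonempty with h | h
  · refine ⟨1, one_pos, 1, one_pos, fun x hx hx1 => ?_⟩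
    exact absurd (show x ∈ K ∩ Metric.sphere 0 1 from ⟨hx, by simpa using hx1⟩) (by simp [h])
  · obtain ⟨y, ⟨hyK, hy1⟩, hy⟩ := hcomp.exists_isMinOn h hcont
    obtain ⟨z, ⟨hzK, hz1⟩, hz⟩ := hcomp.exists_isMaxOn h hcont
    have hne : ∀ u : Fin d → ℝ, u ∈ Metric.sphere 0 1 → u ≠ 0 := by
      rintro u hu rfl
      simp at hu
    refine ⟨g y, hpos y hyK (hne y hy1), g z, hpos z hzK (hne z hz1), fun x hx hx1 => ?_⟩
    exact ⟨hy ⟨hx, by simpa using hx1⟩, hz ⟨hx, by simpa using hx1⟩⟩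

lemma exists_norm_bounds {K : Set (Fin d → ℝ)} (hK : IsClosed K)
    (hsmul : ∀ c : ℝ, 0 ≤ c → ∀ x ∈ K, c • x ∈ K) {g : (Fin d → ℝ) → ℝ}
    (hg : ContinuousOn g K) (hpos : ∀ x ∈ K, x ≠ 0 → 0 < g x)
    (hhom : ∀ c : ℝ, 0 ≤ c → ∀ x ∈ K, g (c • x) = c * g x) :
    ∃ c > 0, ∃ C > 0, ∀ x ∈ K, c * ‖x‖ ≤ g x ∧ g x ≤ C * ‖x‖ := by
  obtain ⟨c, hc, C, hC, h⟩ := exists_pos_le_on_sphere hK hg hpos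
  refine ⟨c, hc, C, hC, fun x hx => ?_⟩
  rcases eq_or_ne x 0 with rfl | hx0
  · have := hhom 0 le_rfl 0 hx
    simp only [smul_zero, zero_mul] at this
    simp [this]
  · have hn : 0 < ‖x‖ := norm_pos_iff.2 hx0
    have h1 := h (‖x‖⁻¹ • x) (hsmul _ (by positivity) _ hx)
      (by rw [norm_smul, norm_inv, norm_norm, inv_mul_cancel₀ hn.ne'])
    rw [hhom _ (by positivity) _ hx, inv_mul_eq_div, le_div_iff₀ hn, div_le_iff₀ hn] at h1
    exact h1

lemma continuous_seminorm (N : Seminorm ℝ (Fin d → ℝ)) : Continuous N := by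
  have h : ∀ x, N x ≤ (∑ i, N (Pi.single i 1)) * ‖x‖ := by
    intro x
    have hx : x = ∑ i, x i • (Pi.single i 1 : Fin d → ℝ) := by
      ext j; simp [Finset.sum_apply, Pi.single_apply]
    calc N x = N (∑ i, x i • (Pi.single i 1 : Fin d → ℝ)) := by rw [← hx]
      _ ≤ ∑ i, N (x i • (Pi.single i 1 : Fin d → ℝ)) :=
        Finset.le_sum_of_subadditive N (map_zero N).le (map_add_le_add N) _ _
      _ ≤ ∑ i, N (Pi.single i 1) * ‖x‖ := by
        refine Finset.sum_le_sum fun i _ => ?_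
        rw [map_smul_eq_mul, mul_comm]
        exact mul_le_mul_of_nonneg_left (norm_le_pi_norm x i) (apply_nonneg N _)
      _ = _ := (Finset.sum_mul _ _ _).symm
  have hC : (0 : ℝ) ≤ ∑ i, N (Pi.single i (1 : ℝ) : Fin d → ℝ) :=
    Finset.sum_nonneg fun i _ => apply_nonneg N _
  refine (LipschitzWith.of_le_add_mul ⟨_, hC⟩ fun x y => ?_).continuous
  have h1 := map_add_le_add N y (x - y)
  rw [add_sub_cancel] at h1
  rw [dist_eq_norm]
  exact h1.trans (add_le_add_right (h _) _)

lemma IsNorm.exists_bounds {N : Seminorm ℝ (Fin d → ℝ)} (hN : IsNorm N) :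
    ∃ c > 0, ∃ C > 0, ∀ x, c * ‖x‖ ≤ N x ∧ N x ≤ C * ‖x‖ := by
  obtain ⟨c, hc, C, hC, h⟩ := exists_norm_bounds (K := Set.univ) isClosed_univ
    (fun _ _ _ _ => Set.mem_univ _) (g := N) (continuous_seminorm N).continuousOn
    (fun x _ hx => lt_of_le_of_ne (apply_nonneg N x) fun h => hx (hN x h.symm))
    (fun c hc x _ => by rw [map_smul_eq_mul, Real.norm_of_nonneg hc])
  exact ⟨c, hc, C, hC, fun x => h x (Set.mem_univ x)⟩

attribute [local instance] Matrix.linftyOpNormedRing Matrix.linftyOpNormedAlgebra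

lemma norm_complexify (x : Fin d → ℝ) : ‖complexify d x‖ = ‖x‖ := by
  simp [Pi.norm_def]

/-- The norm is that of the complexified matrix, so that the same quantity appears in Gelfand's
formula for `specRad`. -/
lemma norm_mulVec_le (M : Matrix (Fin d) (Fin d) ℝ) (x : Fin d → ℝ) :
    ‖M.mulVec x‖ ≤ ‖M.map Complex.ofReal‖ * ‖x‖ := by
  rw [← norm_complexify, ← norm_complexify x, ← toLin'_complexify, Matrix.toLin'_apply]
  exact Matrix.linfty_opNorm_mulVec _ _

lemma IsNorm.exists_seminorm_mulVec_le {N : Seminorm ℝ (Fin d → ℝ)} (hN : IsNorm N) :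
    ∃ C > 0, ∀ (M : Matrix (Fin d) (Fin d) ℝ) (x : Fin d → ℝ),
      N (M.mulVec x) ≤ C * ‖M.map Complex.ofReal‖ * N x := by
  obtain ⟨c, hc, C, hC, h⟩ := hN.exists_bounds
  refine ⟨C / c, by positivity, fun M x => ?_⟩
  calc N (M.mulVec x) ≤ C * ‖M.mulVec x‖ := (h _).2
    _ ≤ C * (‖M.map Complex.ofReal‖ * (N x / c)) := by
      gcongr
      refine (norm_mulVec_le M x).trans ?_
      gcongr
      rw [le_div_iff₀ hc, mul_comm]
      exact (h x).1
    _ = _ := by ring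

lemma inducedNorm_nonneg (N : Seminorm ℝ (Fin d → ℝ)) (M : Matrix (Fin d) (Fin d) ℝ) :
    0 ≤ inducedNorm N M := by
  refine Real.sSup_nonneg ?_
  rintro _ ⟨x, -, rfl⟩
  exact apply_nonneg N _

lemma inducedNorm_le {N : Seminorm ℝ (Fin d → ℝ)} {M : Matrix (Fin d) (Fin d) ℝ} {b : ℝ}
    (hb : 0 ≤ b) (h : ∀ x, N (M.mulVec x) ≤ b * N x) : inducedNorm N M ≤ b := by
  refine Real.sSup_le ?_ hb
  rintro _ ⟨x, hx, rfl⟩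
  exact (h x).trans (mul_le_of_le_one_right hb hx)

lemma IsNorm.apply_mulVec_le {N : Seminorm ℝ (Fin d → ℝ)} (hN : IsNorm N)
    (M : Matrix (Fin d) (Fin d) ℝ) (x : Fin d → ℝ) :
    N (M.mulVec x) ≤ inducedNorm N M * N x := by
  obtain ⟨C, hC, h⟩ := hN.exists_seminorm_mulVec_le
  rcases eq_or_ne x 0 with rfl | hx
  · simp
  have hx0 : 0 < N x := lt_of_le_of_ne (apply_nonneg N x) fun h => hx (hN x h.symm)
  -- Boundedness is essential: a real `sSup` of an unbounded set would be `0`.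
  have hbdd : BddAbove {r | ∃ x : Fin d → ℝ, N x ≤ 1 ∧ r = N (M.mulVec x)} := by
    refine ⟨C * ‖M.map Complex.ofReal‖, ?_⟩
    rintro _ ⟨y, hy, rfl⟩
    exact (h M y).trans (mul_le_of_le_one_right (by positivity) hy)
  have h1 : N (M.mulVec ((N x)⁻¹ • x)) ≤ inducedNorm N M := by
    refine le_csSup hbdd ⟨_, ?_, rfl⟩
    rw [map_smul_eq_mul, Real.norm_of_nonneg (by positivity), inv_mul_cancel₀ hx0.ne']
  rwa [Matrix.mulVec_smul, map_smul_eq_mul, Real.norm_of_nonneg (by positivity), inv_mul_eq_div,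
    div_le_iff₀ hx0] at h1

lemma IsNorm.inducedNorm_mul_le {N : Seminorm ℝ (Fin d → ℝ)} (hN : IsNorm N)
    (M M' : Matrix (Fin d) (Fin d) ℝ) :
    inducedNorm N (M * M') ≤ inducedNorm N M * inducedNorm N M' := by
  refine inducedNorm_le (mul_nonneg (inducedNorm_nonneg N M) (inducedNorm_nonneg N M'))
    fun x => ?_
  rw [← Matrix.mulVec_mulVec, mul_assoc]
  exact (hN.apply_mulVec_le M _).trans
    (mul_le_mul_of_nonneg_left (hN.apply_mulVec_le M' x) (inducedNorm_nonneg N M))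

lemma IsNorm.exists_inducedNorm_le {N : Seminorm ℝ (Fin d → ℝ)} (hN : IsNorm N) :
    ∃ C > 0, ∀ M : Matrix (Fin d) (Fin d) ℝ, inducedNorm N M ≤ C * ‖M.map Complex.ofReal‖ := by
  obtain ⟨C, hC, h⟩ := hN.exists_seminorm_mulVec_le
  exact ⟨C, hC, fun M => inducedNorm_le (by positivity) (h M)⟩

/-- Gelfand's formula. -/
lemma tendsto_norm_pow_specRad {M : Matrix (Fin d) (Fin d) ℝ} (hM : 0 < specRad M) :
    Tendsto (fun n : ℕ => ‖(M ^ n).map Complex.ofReal‖ ^ (1 / n : ℝ)) atTop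
      (𝓝 (specRad M)) := by
  -- An infinite spectral radius would have `toReal` equal to `0`.
  have hfin : spectralRadius ℂ (M.map Complex.ofReal) ≠ ⊤ := by
    intro h
    rw [specRad, h] at hM
    simp at hM
  have h := (ENNReal.tendsto_toReal hfin).comp
    (spectrum.pow_norm_pow_one_div_tendsto_nhds_spectralRadius (M.map Complex.ofReal))
  refine h.congr fun n => ?_
  have hmap : (M ^ n).map Complex.ofReal = M.map Complex.ofReal ^ n :=
    map_pow (Complex.ofRealHom.mapMatrix (m := Fin d)) M n
  rw [Function.comp_apply, ENNReal.toReal_ofReal (by positivity), hmap]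

end Norms

/-! ### Existence of the lower spectral radius and its bound by spectral radii. -/

section Limit

variable {d m : ℕ}

attribute [local instance] Matrix.linftyOpNormedRing Matrix.linftyOpNormedAlgebra

lemma tendsto_const_rpow_one_div {C : ℝ} (hC : 0 < C) :
    Tendsto (fun n : ℕ => C ^ (1 / n : ℝ)) atTop (𝓝 1) := by
  have h : Tendsto (fun n : ℕ => (1 / n : ℝ)) atTop (𝓝 0) := tendsto_one_div_atTop_nhds_zero_nat
  simpa [Function.comp_def] using (Real.continuousAt_const_rpow hC.ne').tendsto.comp h

lemma wordProd_append (A : Fin m → Matrix (Fin d) (Fin d) ℝ) (u v : List (Fin m)) :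
    wordProd A (u ++ v) = wordProd A u * wordProd A v := by
  simp [wordProd]

lemma wordProd_flatten_replicate (A : Fin m → Matrix (Fin d) (Fin d) ℝ) (w : List (Fin m))
    (n : ℕ) : wordProd A (List.replicate n w).flatten = wordProd A w ^ n := by
  induction n with
  | zero => simp [wordProd]
  | succ n ih => rw [List.replicate_succ, List.flatten_cons, wordProd_append, ih, pow_succ']

lemma minNormRoot_le (N : Seminorm ℝ (Fin d → ℝ)) (A : Fin m → Matrix (Fin d) (Fin d) ℝ)
    {w : List (Fin m)} {k : ℕ} (hw : w.length = k) :
    minNormRoot N A k ≤ inducedNorm N (wordProd A w) ^ ((1 : ℝ) / k) := by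
  refine csInf_le ⟨0, ?_⟩ ⟨w, hw, rfl⟩
  rintro _ ⟨v, -, rfl⟩
  exact Real.rpow_nonneg (inducedNorm_nonneg _ _) _

lemma exists_minNormRoot_eq (hm : 0 < m) (N : Seminorm ℝ (Fin d → ℝ))
    (A : Fin m → Matrix (Fin d) (Fin d) ℝ) (k : ℕ) :
    ∃ w : List (Fin m), w.length = k ∧
      minNormRoot N A k = inducedNorm N (wordProd A w) ^ ((1 : ℝ) / k) := by
  have hfin : {r | ∃ w : List (Fin m), w.length = k ∧
      r = inducedNorm N (wordProd A w) ^ ((1 : ℝ) / k)}.Finite := by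
    refine ((List.finite_length_eq (Fin m) k).image
      fun w => inducedNorm N (wordProd A w) ^ ((1 : ℝ) / k)).subset ?_
    rintro _ ⟨w, hw, rfl⟩
    exact ⟨w, hw, rfl⟩
  refine Set.Nonempty.csInf_mem ?_ hfin
  exact ⟨_, List.replicate k ⟨0, hm⟩, by simp, rfl⟩

lemma minNormRoot_nonneg (N : Seminorm ℝ (Fin d → ℝ)) (A : Fin m → Matrix (Fin d) (Fin d) ℝ)
    (k : ℕ) : 0 ≤ minNormRoot N A k := by
  refine Real.sInf_nonneg ?_
  rintro _ ⟨v, -, rfl⟩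
  exact Real.rpow_nonneg (inducedNorm_nonneg _ _) _

/-- The limit defining the lower spectral radius exists as soon as the norms of the products decay
at most exponentially. -/
lemma tendsto_minNormRoot (hm : 0 < m) {N : Seminorm ℝ (Fin d → ℝ)} (hN : IsNorm N)
    {A : Fin m → Matrix (Fin d) (Fin d) ℝ} {c r : ℝ} (hc : 0 < c) (hr : 0 < r)
    (hlow : ∀ w : List (Fin m), c * r ^ w.length ≤ inducedNorm N (wordProd A w)) :
    Tendsto (minNormRoot N A) atTop (𝓝 (lsr N A)) := by
  have hpos : ∀ w : List (Fin m), 0 < inducedNorm N (wordProd A w) := fun w =>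
    lt_of_lt_of_le (by positivity) (hlow w)
  have hlog : ∀ k : ℕ, k ≠ 0 → ∃ w : List (Fin m), w.length = k ∧
      k * Real.log (minNormRoot N A k) = Real.log (inducedNorm N (wordProd A w)) := by
    intro k hk
    obtain ⟨w, hw, h⟩ := exists_minNormRoot_eq hm N A k
    refine ⟨w, hw, ?_⟩
    rw [h, Real.log_rpow (hpos w)]
    field_simp
  have hlog_le : ∀ w : List (Fin m), w ≠ [] →
      w.length * Real.log (minNormRoot N A w.length) ≤
        Real.log (inducedNorm N (wordProd A w)) := by
    intro w hw
    have hl : (0 : ℝ) < w.length := by exact_mod_cast List.length_pos_iff.2 hw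
    obtain ⟨v, -, hv⟩ := exists_minNormRoot_eq hm N A w.length
    have h1 := Real.log_le_log (by rw [hv]; exact Real.rpow_pos_of_pos (hpos v) _)
      (minNormRoot_le N A (w := w) rfl)
    rw [Real.log_rpow (hpos w)] at h1
    calc _ ≤ w.length * (1 / w.length * Real.log (inducedNorm N (wordProd A w))) := by gcongr
      _ = _ := by field_simp
  -- Fekete's lemma is applied to the logarithm of the minimal norm in degree `k`. The factor `k`
  -- makes the degree-zero term vanish.
  have hsub : Subadditive fun k : ℕ => (k : ℝ) * Real.log (minNormRoot N A k) := by
    intro k l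
    rcases eq_or_ne k 0 with rfl | hk
    · simp
    rcases eq_or_ne l 0 with rfl | hl
    · simp
    obtain ⟨u, rfl, hu'⟩ := hlog k hk
    obtain ⟨v, rfl, hv'⟩ := hlog l hl
    dsimp only
    rw [hu', hv', ← Real.log_mul (hpos u).ne' (hpos v).ne']
    have h1 := hlog_le (u ++ v) (by rintro h; simp_all)
    rw [List.length_append] at h1
    refine h1.trans (Real.log_le_log (hpos _) ?_)
    rw [wordProd_append]
    exact hN.inducedNorm_mul_le _ _
  have hbdd : BddBelow (Set.range fun k : ℕ => (k : ℝ) * Real.log (minNormRoot N A k) / k) := by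
    -- The inner minimum absorbs `log c / k` for every `k ≥ 1`, whatever the sign of `log c`; the
    -- outer one covers `k = 0`, where the quotient is `0`.
    refine ⟨min 0 (min 0 (Real.log c) + Real.log r), ?_⟩
    rintro _ ⟨k, rfl⟩
    rcases eq_or_ne k 0 with rfl | hk
    · simp
    refine (min_le_right _ _).trans ?_
    obtain ⟨w, hw, h⟩ := hlog k hk
    have hk1 : (1 : ℝ) ≤ k := by exact_mod_cast Nat.one_le_iff_ne_zero.2 hk
    dsimp only
    rw [h, le_div_iff₀ (by linarith)]
    have h1 := Real.log_le_log (by positivity) (hlow w)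
    rw [Real.log_mul hc.ne' (by positivity), Real.log_pow, hw] at h1
    have h2 : min 0 (Real.log c) * k ≤ min 0 (Real.log c) * 1 :=
      mul_le_mul_of_nonpos_left hk1 (min_le_left _ _)
    have h3 := min_le_right 0 (Real.log c)
    linarith
  have hlim : Tendsto (minNormRoot N A) atTop (𝓝 (Real.exp hsub.lim)) := by
    refine ((Real.continuous_exp.tendsto _).comp (hsub.tendsto_lim hbdd)).congr' ?_
    filter_upwards [eventually_ne_atTop 0] with k hk
    have hk' : (k : ℝ) ≠ 0 := by exact_mod_cast hk
    obtain ⟨w, -, hw⟩ := exists_minNormRoot_eq hm N A k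
    rw [Function.comp_apply, mul_div_cancel_left₀ _ hk', Real.exp_log]
    rw [hw]
    exact Real.rpow_pos_of_pos (hpos w) _
  exact tendsto_nhds_limUnder ⟨_, hlim⟩

/-- Along degrees `n * w.length`, the power `w ^ n` is a competitor in the minimum. Gelfand's
formula gives its growth, and the norm-comparison constant disappears under the `n`-th root. -/
lemma lsr_le_specRad {N : Seminorm ℝ (Fin d → ℝ)} (hN : IsNorm N)
    {A : Fin m → Matrix (Fin d) (Fin d) ℝ}
    (hlim : Tendsto (minNormRoot N A) atTop (𝓝 (lsr N A)))
    {w : List (Fin m)} (hw : w ≠ []) (hρ : 0 < specRad (wordProd A w)) :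
    lsr N A ≤ specRad (wordProd A w) ^ ((1 : ℝ) / w.length) := by
  have hl : 0 < w.length := List.length_pos_iff.2 hw
  obtain ⟨C, hC, h⟩ := hN.exists_inducedNorm_le
  have h1 : Tendsto (fun n : ℕ => minNormRoot N A (n * w.length)) atTop (𝓝 (lsr N A)) :=
    hlim.comp (tendsto_id.atTop_mul_const' hl)
  have h2 := ((tendsto_const_rpow_one_div hC).mul (tendsto_norm_pow_specRad hρ)).rpow_const
    (p := (1 : ℝ) / w.length) (Or.inr (by positivity))
  rw [one_mul] at h2
  refine le_of_tendsto_of_tendsto' h1 h2 fun n => ?_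
  have h3 := minNormRoot_le N A (w := (List.replicate n w).flatten) (k := n * w.length) (by simp)
  rw [wordProd_flatten_replicate] at h3
  refine h3.trans ?_
  rw [← Real.mul_rpow hC.le (norm_nonneg _), ← Real.rpow_mul (mul_nonneg hC.le (norm_nonneg _))]
  rw [Nat.cast_mul, one_div_mul_one_div]
  exact Real.rpow_le_rpow (inducedNorm_nonneg _ _) (h _) (by positivity)

end Limit

/-! ### Uniform expansion on the cone and operator antinorms. -/

section Antinorm

variable {d m : ℕ}

lemma IsInvariantCone.wordProd_mulVec_mem {K : Set (Fin d → ℝ)}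
    {A : Fin m → Matrix (Fin d) (Fin d) ℝ} (hK : IsInvariantCone K A) (w : List (Fin m))
    {x : Fin d → ℝ} (hx : x ∈ K) : (wordProd A w).mulVec x ∈ K := by
  induction w with
  | nil => simpa [wordProd] using hx
  | cons i w ih =>
    have h : wordProd A (i :: w) = A i * wordProd A w := by simp [wordProd]
    rw [h, ← Matrix.mulVec_mulVec]
    exact hK.2 i _ ih

lemma smul_mem_secondarySet {A : Fin m → Matrix (Fin d) (Fin d) ℝ} (c : ℝ) {x : Fin d → ℝ}
    (hx : x ∈ secondarySet A) : c • x ∈ secondarySet A := by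
  simp only [secondarySet, Set.mem_iUnion] at hx ⊢
  obtain ⟨w, hw, hx⟩ := hx
  exact ⟨w, hw, Submodule.smul_mem _ c hx⟩

/-- If the cone meets the closure of the secondary set only at the origin, then its points keep a
distance from the secondary set proportional to their norm. -/
lemma exists_mul_norm_le_norm_sub {K : Set (Fin d → ℝ)} (hK : IsProperCone K)
    {A : Fin m → Matrix (Fin d) (Fin d) ℝ} (hH : K ∩ closure (secondarySet A) = {0}) :
    ∃ c > 0, ∀ x ∈ K, ∀ h ∈ secondarySet A, c * ‖x‖ ≤ ‖x - h‖ := by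
  -- Needed because `infDist` to the empty set is `0` by convention.
  have hne : (secondarySet A).Nonempty := by
    have h0 : (0 : Fin d → ℝ) ∈ K ∩ closure (secondarySet A) := by simp [hH]
    exact closure_nonempty_iff.1 ⟨0, h0.2⟩
  obtain ⟨c, hc, _, _, h⟩ := exists_pos_le_on_sphere hK.isClosed
    (g := fun x => Metric.infDist x (secondarySet A))
    (Metric.continuous_infDist_pt _).continuousOn fun x hx hx0 => by
      have hx' : x ∉ closure (secondarySet A) := fun h => hx0 <| by
        have : x ∈ K ∩ closure (secondarySet A) := ⟨hx, h⟩
        simpa [hH] using this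
      refine lt_of_le_of_ne Metric.infDist_nonneg fun h => hx' ?_
      exact (Metric.mem_closure_iff_infDist_zero hne).2 h.symm
  refine ⟨c, hc, fun x hx y hy => ?_⟩
  rcases eq_or_ne x 0 with rfl | hx0
  · simp
  have hn : 0 < ‖x‖ := norm_pos_iff.2 hx0
  have h1 := (h (‖x‖⁻¹ • x) (hK.smul_mem _ (by positivity) _ hx)
    (by rw [norm_smul, norm_inv, norm_norm, inv_mul_cancel₀ hn.ne'])).1.trans
    (Metric.infDist_le_dist_of_mem (smul_mem_secondarySet ‖x‖⁻¹ hy))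
  rwa [dist_eq_norm, ← smul_sub, norm_smul, norm_inv, norm_norm, inv_mul_eq_div,
    le_div_iff₀ hn] at h1

/-- On the cone every product expands by its spectral radius, up to a uniform constant. -/
lemma exists_mul_specRad_mul_norm_le {K : Set (Fin d → ℝ)} (hK : IsProperCone K)
    {A : Fin m → Matrix (Fin d) (Fin d) ℝ} (hA : AsymptRankOneFamily A)
    (hH : K ∩ closure (secondarySet A) = {0}) :
    ∃ c > 0, ∀ w : List (Fin m), w ≠ [] → ∀ x ∈ K,
      c * specRad (wordProd A w) * ‖x‖ ≤ ‖(wordProd A w).mulVec x‖ := by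
  obtain ⟨c, hc, hdist⟩ := exists_mul_norm_le_norm_sub hK hH
  -- The dimension comes from bounding `|f ⬝ᵥ y|` by the `ℓ¹` norm of `f` times the sup norm of `y`;
  -- the added `1` only keeps the denominator positive.
  refine ⟨c / (d + 1), by positivity, fun w hw x hx => ?_⟩
  obtain ⟨f, hf0, hfeq, hker⟩ := (hA w hw).exists_functional
  obtain ⟨i₀, -⟩ := Function.ne_iff.1 hf0
  obtain ⟨j, -, hj⟩ := Finset.exists_max_image Finset.univ (fun i => |f i|) ⟨i₀, Finset.mem_univ _⟩
  have hfj : 0 < |f j| := by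
    rw [abs_pos]
    intro h0
    refine hf0 (funext fun i => ?_)
    have := hj i (Finset.mem_univ _)
    rw [h0, abs_zero] at this
    exact abs_nonpos_iff.1 this
  have hupper : ∀ y : Fin d → ℝ, |f ⬝ᵥ y| ≤ (d + 1) * |f j| * ‖y‖ := by
    intro y
    calc |f ⬝ᵥ y| ≤ ∑ i, |f i * y i| := Finset.abs_sum_le_sum_abs _ _
      _ ≤ ∑ _i : Fin d, |f j| * ‖y‖ := by
        refine Finset.sum_le_sum fun i hi => ?_
        rw [abs_mul]
        exact mul_le_mul (hj i hi) (norm_le_pi_norm y i) (abs_nonneg _) (abs_nonneg _)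
      _ = d * (|f j| * ‖y‖) := by simp
      _ ≤ _ := by
        have : 0 ≤ |f j| * ‖y‖ := by positivity
        linarith
  have hlower : c * ‖x‖ * |f j| ≤ |f ⬝ᵥ x| := by
    -- Moving `x` by `r` along coordinate `j` lands in the kernel of `f`, hence in the secondary
    -- set, so `|r|` is at least `c * ‖x‖`. Taking `j` where `|f j|` is largest lets `f` cancel from
    -- the final constant.
    set r := (f ⬝ᵥ x) / f j with hr
    have hmem : x - Pi.single j r ∈ secondarySet A := by
      simp only [secondarySet, Set.mem_iUnion]
      refine ⟨w, hw, hker _ ?_⟩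
      rw [dotProduct_sub, dotProduct_single, hr, mul_div_cancel₀ _ (abs_pos.1 hfj), sub_self]
    have h1 := hdist x hx _ hmem
    rwa [sub_sub_cancel, Pi.norm_single, Real.norm_eq_abs, hr, abs_div, le_div_iff₀ hfj] at h1
  have hρ := (hA w hw).1
  have h1 : specRad (wordProd A w) * (c * ‖x‖ * |f j|) ≤
      (d + 1) * |f j| * ‖(wordProd A w).mulVec x‖ :=
    calc _ ≤ specRad (wordProd A w) * |f ⬝ᵥ x| := by gcongr
      _ = |f ⬝ᵥ (wordProd A w).mulVec x| := (hfeq x).symm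
      _ ≤ _ := hupper _
  rw [div_mul_eq_mul_div, div_mul_eq_mul_div, div_le_iff₀ (by positivity)]
  refine le_of_mul_le_mul_right ?_ hfj
  linarith

lemma IsPositiveAntinorm.exists_bounds {K : Set (Fin d → ℝ)} (hK : IsProperCone K)
    {a : (Fin d → ℝ) → ℝ} (ha : IsPositiveAntinorm K a) :
    ∃ c > 0, ∃ C > 0, ∀ x ∈ K, c * ‖x‖ ≤ a x ∧ a x ≤ C * ‖x‖ :=
  exists_norm_bounds hK.isClosed hK.smul_mem ha.1.continuousOn ha.2 ha.1.smul

lemma IsPositiveAntinorm.exists_eq_one {K : Set (Fin d → ℝ)} (hK : IsProperCone K)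
    {a : (Fin d → ℝ) → ℝ} (ha : IsPositiveAntinorm K a) : ∃ x ∈ K, a x = 1 := by
  obtain ⟨x, hx, hax⟩ := ha.1.nontrivial
  have h0 : 0 < a x := lt_of_le_of_ne (ha.1.nonneg x hx) hax.symm
  have h1 : 0 ≤ (a x)⁻¹ := by positivity
  exact ⟨(a x)⁻¹ • x, hK.smul_mem _ h1 x hx, by rw [ha.1.smul _ h1 x hx, inv_mul_cancel₀ hax]⟩

/-- A vector with `a x = 1` must exist, since a real `sInf` of the empty set is `0`. -/
lemma le_opAntinorm {K : Set (Fin d → ℝ)} (hK : IsProperCone K) {a : (Fin d → ℝ) → ℝ}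
    (ha : IsPositiveAntinorm K a) {M : Matrix (Fin d) (Fin d) ℝ} {b : ℝ}
    (h : ∀ x ∈ K, a x = 1 → b ≤ a (M.mulVec x)) : b ≤ opAntinorm K a M := by
  obtain ⟨x, hx, hx1⟩ := ha.exists_eq_one hK
  refine le_csInf ⟨_, x, hx, hx1, rfl⟩ ?_
  rintro _ ⟨y, hy, hy1, rfl⟩
  exact h y hy hy1

lemma opAntinorm_mul_le {K : Set (Fin d → ℝ)} (hK : IsProperCone K) {a : (Fin d → ℝ) → ℝ}
    (ha : IsPositiveAntinorm K a) {M : Matrix (Fin d) (Fin d) ℝ}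
    (hM : ∀ x ∈ K, M.mulVec x ∈ K) {x : Fin d → ℝ} (hx : x ∈ K) :
    opAntinorm K a M * a x ≤ a (M.mulVec x) := by
  rcases eq_or_ne (a x) 0 with h | h
  · rw [h, mul_zero]
    exact ha.1.nonneg _ (hM x hx)
  have h0 : 0 < a x := lt_of_le_of_ne (ha.1.nonneg x hx) h.symm
  have h1 : 0 ≤ (a x)⁻¹ := by positivity
  have h2 : opAntinorm K a M ≤ a (M.mulVec ((a x)⁻¹ • x)) := by
    refine csInf_le ⟨0, ?_⟩ ⟨_, hK.smul_mem _ h1 x hx, ?_, rfl⟩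
    · rintro _ ⟨y, hy, -, rfl⟩
      exact ha.1.nonneg _ (hM y hy)
    · rw [ha.1.smul _ h1 x hx, inv_mul_cancel₀ h]
  rwa [Matrix.mulVec_smul, ha.1.smul _ h1 _ (hM x hx), inv_mul_eq_div, le_div_iff₀ h0] at h2

lemma opAntinorm_nonneg {K : Set (Fin d → ℝ)} {a : (Fin d → ℝ) → ℝ}
    (ha : IsPositiveAntinorm K a) {M : Matrix (Fin d) (Fin d) ℝ}
    (hM : ∀ x ∈ K, M.mulVec x ∈ K) : 0 ≤ opAntinorm K a M := by
  refine Real.sInf_nonneg ?_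
  rintro _ ⟨y, hy, -, rfl⟩
  exact ha.1.nonneg _ (hM y hy)

/-- Supermultiplicativity, the mirror image of submultiplicativity of a norm; invariance of `K`
allows the two lower bounds to be chained. -/
lemma opAntinorm_wordProd_append {K : Set (Fin d → ℝ)} {A : Fin m → Matrix (Fin d) (Fin d) ℝ}
    (hK : IsInvariantCone K A) {a : (Fin d → ℝ) → ℝ} (ha : IsPositiveAntinorm K a)
    (u v : List (Fin m)) :
    opAntinorm K a (wordProd A u) * opAntinorm K a (wordProd A v) ≤
      opAntinorm K a (wordProd A (u ++ v)) := by
  refine le_opAntinorm hK.1 ha fun x hx hx1 => ?_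
  rw [wordProd_append, ← Matrix.mulVec_mulVec]
  have hu : ∀ x ∈ K, (wordProd A u).mulVec x ∈ K := fun x hx => hK.wordProd_mulVec_mem u hx
  have hv : ∀ x ∈ K, (wordProd A v).mulVec x ∈ K := fun x hx => hK.wordProd_mulVec_mem v hx
  have h1 := opAntinorm_mul_le hK.1 ha hv hx
  rw [hx1, mul_one] at h1
  exact (mul_le_mul_of_nonneg_left h1 (opAntinorm_nonneg ha hu)).trans
    (opAntinorm_mul_le hK.1 ha hu (hv x hx))

lemma opAntinorm_wordProd_nil {K : Set (Fin d → ℝ)} (hK : IsProperCone K)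
    {a : (Fin d → ℝ) → ℝ} (ha : IsPositiveAntinorm K a)
    (A : Fin m → Matrix (Fin d) (Fin d) ℝ) : 1 ≤ opAntinorm K a (wordProd A []) :=
  le_opAntinorm hK ha fun x _ hx1 => by simp [wordProd, hx1]

/-- The spectral radius of a product is at most a uniform multiple of its operator antinorm. -/
lemma exists_mul_specRad_le_opAntinorm {K : Set (Fin d → ℝ)}
    {A : Fin m → Matrix (Fin d) (Fin d) ℝ} (hK : IsInvariantCone K A)
    (hA : AsymptRankOneFamily A) (hH : K ∩ closure (secondarySet A) = {0})
    {a : (Fin d → ℝ) → ℝ} (ha : IsPositiveAntinorm K a) :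
    ∃ c > 0, ∀ w : List (Fin m), w ≠ [] →
      c * specRad (wordProd A w) ≤ opAntinorm K a (wordProd A w) := by
  obtain ⟨c₁, hc₁, hexp⟩ := exists_mul_specRad_mul_norm_le hK.1 hA hH
  obtain ⟨c₂, hc₂, C, hC, hbd⟩ := ha.exists_bounds hK.1
  refine ⟨c₂ * c₁ / C, by positivity, fun w hw => le_opAntinorm hK.1 ha fun x hx hx1 => ?_⟩
  have hρ := (hA w hw).1
  have h1 : C⁻¹ ≤ ‖x‖ := by
    rw [inv_le_iff_one_le_mul₀' hC, ← hx1]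
    exact (hbd x hx).2
  calc c₂ * c₁ / C * specRad (wordProd A w)
      = c₂ * (c₁ * specRad (wordProd A w) * C⁻¹) := by ring
    _ ≤ c₂ * (c₁ * specRad (wordProd A w) * ‖x‖) := by gcongr
    _ ≤ c₂ * ‖(wordProd A w).mulVec x‖ := by gcongr; exact hexp w hw x hx
    _ ≤ _ := (hbd _ (hK.wordProd_mulVec_mem w hx)).1

/-- Both quantities are tested on one fixed vector of `K`: the antinorm bounds its image from below,
the induced norm from above. -/
lemma exists_mul_opAntinorm_le_inducedNorm {K : Set (Fin d → ℝ)}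
    {A : Fin m → Matrix (Fin d) (Fin d) ℝ} (hK : IsInvariantCone K A)
    {a : (Fin d → ℝ) → ℝ} (ha : IsPositiveAntinorm K a)
    {N : Seminorm ℝ (Fin d → ℝ)} (hN : IsNorm N) :
    ∃ c > 0, ∀ w : List (Fin m),
      c * opAntinorm K a (wordProd A w) ≤ inducedNorm N (wordProd A w) := by
  obtain ⟨x, hx, hx1⟩ := ha.exists_eq_one hK.1
  obtain ⟨_, _, C, hC, hbd⟩ := ha.exists_bounds hK.1
  obtain ⟨c', hc', _, _, hNbd⟩ := hN.exists_bounds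
  have hNx : 0 < N x := by
    refine lt_of_lt_of_le (mul_pos hc' (norm_pos_iff.2 ?_)) (hNbd x).1
    rintro rfl
    have := (hbd 0 hx).2
    rw [hx1, norm_zero, mul_zero] at this
    linarith
  refine ⟨c' / (C * N x), by positivity, fun w => ?_⟩
  have hM : ∀ x ∈ K, (wordProd A w).mulVec x ∈ K := fun x hx => hK.wordProd_mulVec_mem w hx
  have h1 := opAntinorm_mul_le hK.1 ha hM hx
  rw [hx1, mul_one] at h1
  have h2 : c' * opAntinorm K a (wordProd A w) ≤ C * (inducedNorm N (wordProd A w) * N x) :=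
    calc _ ≤ c' * (C * ‖(wordProd A w).mulVec x‖) := by
          gcongr; exact h1.trans (hbd _ (hM x hx)).2
      _ = C * (c' * ‖(wordProd A w).mulVec x‖) := by ring
      _ ≤ _ := mul_le_mul_of_nonneg_left ((hNbd _).1.trans (hN.apply_mulVec_le _ x)) hC.le
  rw [div_mul_eq_mul_div, div_le_iff₀ (by positivity)]
  linarith

end Antinorm

/-! ### Lower bounds by cutting words into blocks. -/

section Blocks

variable {d m : ℕ}

lemma specRad_nonneg (M : Matrix (Fin d) (Fin d) ℝ) : 0 ≤ specRad M := ENNReal.toReal_nonneg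

lemma le_rpow_one_div_iff {x b : ℝ} (hx : 0 ≤ x) (hb : 0 ≤ b) {j : ℕ} (hj : j ≠ 0) :
    b ≤ x ^ ((1 : ℝ) / j) ↔ b ^ j ≤ x := by
  rw [one_div, Real.le_rpow_inv_iff_of_pos hb hx (by positivity), Real.rpow_natCast]

/-- Each generator has positive operator antinorm because its spectral radius is positive;
supermultiplicativity spreads their minimum to all words. -/
lemma exists_pow_le_opAntinorm {K : Set (Fin d → ℝ)}
    {A : Fin m → Matrix (Fin d) (Fin d) ℝ} (hK : IsInvariantCone K A)
    (hA : AsymptRankOneFamily A) (hH : K ∩ closure (secondarySet A) = {0})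
    {a : (Fin d → ℝ) → ℝ} (ha : IsPositiveAntinorm K a) :
    ∃ μ > 0, ∀ w : List (Fin m), μ ^ w.length ≤ opAntinorm K a (wordProd A w) := by
  obtain ⟨c, hc, h⟩ := exists_mul_specRad_le_opAntinorm hK hA hH ha
  have hpos : ∀ i, 0 < opAntinorm K a (wordProd A [i]) := fun i =>
    lt_of_lt_of_le (mul_pos hc (hA [i] (by simp)).1) (h [i] (by simp))
  obtain ⟨μ, hμ, hle⟩ : ∃ μ > 0, ∀ i, μ ≤ opAntinorm K a (wordProd A [i]) := by
    rcases isEmpty_or_nonempty (Fin m) with he | he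
    · exact ⟨1, one_pos, fun i => he.elim i⟩
    · obtain ⟨i₀, hi₀⟩ := Finite.exists_min fun i => opAntinorm K a (wordProd A [i])
      exact ⟨_, hpos i₀, hi₀⟩
  refine ⟨μ, hμ, fun w => ?_⟩
  induction w with
  | nil => simpa using opAntinorm_wordProd_nil hK.1 ha A
  | cons i w ih =>
    rw [List.length_cons, pow_succ']
    exact (mul_le_mul (hle i) ih (by positivity) (hpos i).le).trans
      (opAntinorm_wordProd_append hK ha [i] w)

/-- If every long word has a prefix of bounded length on which the antinorm grows at rate `β`,
then `β` is a lower bound for the lower spectral radius. -/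
lemma le_lsr_of_prefix (hm : 0 < m) {K : Set (Fin d → ℝ)}
    {A : Fin m → Matrix (Fin d) (Fin d) ℝ} (hK : IsInvariantCone K A)
    (hA : AsymptRankOneFamily A) (hH : K ∩ closure (secondarySet A) = {0})
    {a : (Fin d → ℝ) → ℝ} (ha : IsPositiveAntinorm K a)
    {N : Seminorm ℝ (Fin d → ℝ)} (hN : IsNorm N)
    (hlim : Tendsto (minNormRoot N A) atTop (𝓝 (lsr N A))) {β : ℝ} {k : ℕ}
    (hβ : ∀ w : List (Fin m), k ≤ w.length → ∃ j, 1 ≤ j ∧ j ≤ k ∧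
      β ≤ opAntinorm K a (wordProd A (w.take j)) ^ ((1 : ℝ) / j)) :
    β ≤ lsr N A := by
  have hlsr : 0 ≤ lsr N A := ge_of_tendsto' hlim fun n => minNormRoot_nonneg N A n
  rcases le_or_gt β 0 with hβ0 | hβ0
  · exact hβ0.trans hlsr
  obtain ⟨μ, hμ, hμw⟩ := exists_pow_le_opAntinorm hK hA hH ha
  obtain ⟨c, hc, hcw⟩ := exists_mul_opAntinorm_le_inducedNorm hK ha hN
  have hα : ∀ w, 0 ≤ opAntinorm K a (wordProd A w) := fun w =>
    opAntinorm_nonneg ha fun x hx => hK.wordProd_mulVec_mem w hx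
  -- The factor `r ^ k` pays for the tail: when `n < k`, it is at most `r ^ n`, and `r * β ≤ μ`
  -- reduces the claim to the crude bound `μ ^ n`. Longer words lose a block of rate `β` and keep
  -- the same factor `r ^ k`.
  set r := min 1 (μ / β) with hr
  have hr0 : 0 < r := by positivity
  have hr1 : r ≤ 1 := min_le_left _ _
  have hrβ : r * β ≤ μ := (le_div_iff₀ hβ0).1 (min_le_right _ _)
  have hgrow : ∀ n, ∀ w : List (Fin m), w.length = n →
      r ^ k * β ^ n ≤ opAntinorm K a (wordProd A w) := by
    intro n
    induction n using Nat.strong_induction_on with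
    | _ n ih =>
      intro w hw
      rcases lt_or_ge n k with hnk | hnk
      · calc r ^ k * β ^ n ≤ r ^ n * β ^ n :=
              mul_le_mul_of_nonneg_right (pow_le_pow_of_le_one hr0.le hr1 hnk.le) (by positivity)
          _ = (r * β) ^ n := (mul_pow _ _ _).symm
          _ ≤ μ ^ n := pow_le_pow_left₀ (by positivity) hrβ n
          _ ≤ _ := hw ▸ hμw w
      · obtain ⟨j, hj1, hjk, hj⟩ := hβ w (hw ▸ hnk)
        rw [le_rpow_one_div_iff (hα _) hβ0.le (by omega)] at hj
        have h1 := ih (n - j) (by omega) (w.drop j) (by rw [List.length_drop, hw])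
        have h2 := opAntinorm_wordProd_append hK ha (w.take j) (w.drop j)
        rw [List.take_append_drop] at h2
        refine le_trans ?_ h2
        calc r ^ k * β ^ n = β ^ j * (r ^ k * β ^ (n - j)) := by
              rw [mul_left_comm, ← pow_add, Nat.add_sub_cancel' (hjk.trans hnk)]
          _ ≤ _ := mul_le_mul hj h1 (by positivity) (hα _)
  -- The constant in front of `β ^ n` is independent of `n`, so its `n`-th root tends to `1`.
  have hl := (tendsto_const_rpow_one_div (C := c * r ^ k) (by positivity)).mul_const β
  rw [one_mul] at hl
  refine le_of_tendsto_of_tendsto hl hlim ?_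
  filter_upwards [eventually_ne_atTop 0] with n hn
  obtain ⟨w, hw, h⟩ := exists_minNormRoot_eq hm N A n
  rw [h, le_rpow_one_div_iff (inducedNorm_nonneg _ _) (by positivity) hn, mul_pow, one_div,
    Real.rpow_inv_natCast_pow (by positivity) hn]
  calc c * r ^ k * β ^ n = c * (r ^ k * β ^ n) := by ring
    _ ≤ c * opAntinorm K a (wordProd A w) := by gcongr; exact hgrow n w hw
    _ ≤ _ := hcw w

end Blocks

/-! ### Combinatorics of the pruned tree and its termination. -/

section Stages

variable {d m : ℕ} {A : Fin m → Matrix (Fin d) (Fin d) ℝ} {K : Set (Fin d → ℝ)}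
  {a : (Fin d → ℝ) → ℝ} {δ : ℝ}

lemma finite_qVal_values (w : List (Fin m)) :
    ((fun j : ℕ => opAntinorm K a (wordProd A (w.take j)) ^ ((1 : ℝ) / (j : ℝ))) ''
      Set.Icc 1 w.length).Finite :=
  (Set.finite_Icc _ _).image _

lemma rpow_le_qVal {w : List (Fin m)} {j : ℕ} (hj1 : 1 ≤ j) (hj : j ≤ w.length) :
    opAntinorm K a (wordProd A (w.take j)) ^ ((1 : ℝ) / j) ≤ qVal A K a w :=
  le_csSup (finite_qVal_values w).bddAbove ⟨j, ⟨hj1, hj⟩, rfl⟩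

lemma exists_qVal_eq {w : List (Fin m)} (hw : 1 ≤ w.length) :
    ∃ j, 1 ≤ j ∧ j ≤ w.length ∧
      opAntinorm K a (wordProd A (w.take j)) ^ ((1 : ℝ) / j) = qVal A K a w := by
  obtain ⟨j, ⟨hj1, hj⟩, h⟩ := ((Set.nonempty_Icc.2 hw).image _).csSup_mem
    (finite_qVal_values (A := A) (K := K) (a := a) w)
  exact ⟨j, hj1, hj, h⟩

/-- An extension keeps all prefixes, so the maximum can only grow. Hence a rejected word has no
descendant worth keeping. -/
lemma qVal_le_qVal_append {v : List (Fin m)} (hv : 1 ≤ v.length) (u : List (Fin m)) :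
    qVal A K a v ≤ qVal A K a (v ++ u) := by
  obtain ⟨j, hj1, hj, h⟩ := exists_qVal_eq (A := A) (K := K) (a := a) hv
  rw [← h, ← List.take_append_of_le_length (l₂ := u) hj]
  exact rpow_le_qVal hj1 (by rw [List.length_append]; omega)

lemma length_of_mem_stage {n : ℕ} {w : List (Fin m)} (hw : w ∈ (stage A K a δ n).S) :
    w.length = n + 1 := by
  induction n generalizing w with
  | zero => obtain ⟨i, rfl⟩ := hw; rfl
  | succ n ih =>
    obtain ⟨v, hv, i, rfl, -⟩ := hw
    simp [ih hv]

lemma finite_stage (n : ℕ) : (stage A K a δ n).S.Finite :=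
  (List.finite_length_eq (Fin m) (n + 1)).subset fun _ => length_of_mem_stage

lemma stage_succ_s (n : ℕ) : (stage A K a δ (n + 1)).s =
    sInf (insert (stage A K a δ n).s
      ((fun w => specRad (wordProd A w) ^ ((1 : ℝ) / (n + 2 : ℕ))) ''
        (stage A K a δ (n + 1)).S)) := rfl

lemma stage_succ_t (n : ℕ) : (stage A K a δ (n + 1)).t =
    max (stage A K a δ n).t (sInf (insert ((stage A K a δ (n + 1)).s - δ)
      (qVal A K a '' (stage A K a δ (n + 1)).S))) := rfl

lemma upper_values_finite (n : ℕ) : (insert (stage A K a δ n).s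
    ((fun w => specRad (wordProd A w) ^ ((1 : ℝ) / (n + 2 : ℕ))) ''
      (stage A K a δ (n + 1)).S)).Finite :=
  ((finite_stage (n + 1)).image _).insert _

lemma lower_values_finite (n : ℕ) : (insert ((stage A K a δ n).s - δ)
    (qVal A K a '' (stage A K a δ n).S)).Finite :=
  ((finite_stage n).image _).insert _

lemma antitone_stage_s : Antitone fun n => (stage A K a δ n).s := by
  refine antitone_nat_of_succ_le fun n => ?_
  rw [stage_succ_s]
  exact csInf_le (upper_values_finite n).bddBelow (Set.mem_insert _ _)

lemma monotone_stage_t : Monotone fun n => (stage A K a δ n).t := by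
  refine monotone_nat_of_le_succ fun n => ?_
  rw [stage_succ_t]
  exact le_max_left _ _

lemma stage_s_le {n : ℕ} {w : List (Fin m)} (hw : w ∈ (stage A K a δ (n + 1)).S) :
    (stage A K a δ (n + 1)).s ≤ specRad (wordProd A w) ^ ((1 : ℝ) / (n + 2 : ℕ)) := by
  rw [stage_succ_s]
  exact csInf_le (upper_values_finite n).bddBelow (Set.mem_insert_of_mem _ ⟨w, hw, rfl⟩)

lemma le_stage_s (hm : 0 < m) {b : ℝ}
    (hb : ∀ w : List (Fin m), w ≠ [] → b ≤ specRad (wordProd A w) ^ ((1 : ℝ) / w.length))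
    (n : ℕ) : b ≤ (stage A K a δ n).s := by
  induction n with
  | zero =>
    have : Nonempty (Fin m) := ⟨⟨0, hm⟩⟩
    refine le_ciInf fun i => ?_
    simpa [wordProd] using hb [i] (by simp)
  | succ n ih =>
    rw [stage_succ_s]
    refine le_csInf (Set.insert_nonempty _ _) ?_
    rintro _ (rfl | ⟨w, hw, rfl⟩)
    · exact ih
    · have hl : w.length = n + 2 := length_of_mem_stage hw
      have := hb w (by rintro rfl; simp at hl)
      rwa [hl] at this

lemma qVal_singleton (i : Fin m) : qVal A K a [i] = opAntinorm K a (A i) := by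
  simp [qVal, wordProd]

/-- The new lower bound is a maximum with the old one, and the old one is controlled by `q` of the
parent word, which is at most `q` of the child. -/
lemma stage_t_le_qVal {n : ℕ} {w : List (Fin m)} (hw : w ∈ (stage A K a δ n).S) :
    (stage A K a δ n).t ≤ qVal A K a w := by
  induction n generalizing w with
  | zero =>
    obtain ⟨i, rfl⟩ := hw
    rw [qVal_singleton]
    exact ciInf_le (Set.finite_range _).bddBelow i
  | succ n ih =>
    rw [stage_succ_t]
    refine max_le ?_ (csInf_le (lower_values_finite (n + 1)).bddBelow
      (Set.mem_insert_of_mem _ ⟨w, hw, rfl⟩))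
    obtain ⟨v, hv, i, rfl, -⟩ := hw
    refine (ih hv).trans (qVal_le_qVal_append ?_ _)
    rw [length_of_mem_stage hv]
    omega

/-- A word leaves the tree of kept products only through a prefix with a large value of `q`. -/
lemma take_mem_stage_or (n : ℕ) {w : List (Fin m)} (hw : n + 1 ≤ w.length) :
    w.take (n + 1) ∈ (stage A K a δ n).S ∨
      ∃ l, 1 ≤ l ∧ l ≤ n + 1 ∧ (stage A K a δ n).s - δ ≤ qVal A K a (w.take l) := by
  induction n with
  | zero =>
    obtain ⟨i, v, rfl⟩ := List.exists_cons_of_length_pos hw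
    exact Or.inl ⟨i, by simp⟩
  | succ n ih =>
    -- The threshold decreases, so a prefix rejected earlier still exceeds the current one.
    have hs : (stage A K a δ (n + 1)).s ≤ (stage A K a δ n).s := antitone_stage_s n.le_succ
    rcases ih (by omega) with h | ⟨l, hl1, hl, h⟩
    · by_cases hq : qVal A K a (w.take (n + 2)) < (stage A K a δ n).s - δ
      · refine Or.inl ⟨w.take (n + 1), h, w[n + 1], ?_, hq⟩
        rw [List.take_append_getElem]
      · exact Or.inr ⟨n + 2, by omega, le_rfl, by linarith⟩
    · exact Or.inr ⟨l, hl1, by omega, by linarith⟩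

/-- Since `q` is a maximum over prefixes, a large `q` on some prefix is attained by the antinorm of
a still shorter one; this yields the blocks for `le_lsr_of_prefix`. -/
lemma exists_prefix_of_lower_values {n : ℕ} {b : ℝ}
    (hb : ∀ x ∈ insert ((stage A K a δ n).s - δ) (qVal A K a '' (stage A K a δ n).S), b ≤ x)
    (w : List (Fin m)) (hw : n + 1 ≤ w.length) : ∃ j, 1 ≤ j ∧ j ≤ n + 1 ∧
      b ≤ opAntinorm K a (wordProd A (w.take j)) ^ ((1 : ℝ) / j) := by
  obtain ⟨l, hl1, hl, hq⟩ : ∃ l, 1 ≤ l ∧ l ≤ n + 1 ∧ b ≤ qVal A K a (w.take l) := by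
    rcases take_mem_stage_or (A := A) (K := K) (a := a) (δ := δ) n hw with h | ⟨l, hl1, hl, h⟩
    · exact ⟨n + 1, by omega, le_rfl, hb _ (Set.mem_insert_of_mem _ ⟨_, h, rfl⟩)⟩
    · exact ⟨l, hl1, hl, (hb _ (Set.mem_insert _ _)).trans h⟩
  have hlen : (w.take l).length = l := by rw [List.length_take]; omega
  obtain ⟨j, hj1, hj, h⟩ := exists_qVal_eq (A := A) (K := K) (a := a) (w := w.take l) (by omega)
  rw [hlen] at hj
  rw [List.take_take, min_eq_left hj] at h
  exact ⟨j, hj1, hj.trans hl, h ▸ hq⟩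

lemma stage_t_le {b : ℝ}
    (hb : ∀ (β : ℝ) (k : ℕ), (∀ w : List (Fin m), k ≤ w.length → ∃ j, 1 ≤ j ∧ j ≤ k ∧
      β ≤ opAntinorm K a (wordProd A (w.take j)) ^ ((1 : ℝ) / j)) → β ≤ b) (n : ℕ) :
    (stage A K a δ n).t ≤ b := by
  induction n with
  | zero =>
    refine hb _ 1 fun w hw => ⟨1, le_rfl, le_rfl, ?_⟩
    obtain ⟨i, v, rfl⟩ := List.exists_cons_of_length_pos hw
    have h : (⨅ i, opAntinorm K a (A i)) ≤ opAntinorm K a (A i) :=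
      ciInf_le (Set.finite_range _).bddBelow i
    simpa [wordProd, stage, firstStage] using h
  | succ n ih =>
    rw [stage_succ_t]
    refine max_le ih (hb _ (n + 2) fun w hw => exists_prefix_of_lower_values (δ := δ) (n := n + 1) ?_ w hw)
    exact fun x hx => csInf_le (lower_values_finite (n + 1)).bddBelow hx

lemma stage_succ_s_of_eq_empty {n : ℕ} (h : (stage A K a δ (n + 1)).S = ∅) :
    (stage A K a δ (n + 1)).s = (stage A K a δ n).s := by
  rw [stage_succ_s, h]; simp

lemma stage_succ_t_of_eq_empty {n : ℕ} (h : (stage A K a δ (n + 1)).S = ∅) :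
    (stage A K a δ (n + 1)).t = max (stage A K a δ n).t ((stage A K a δ n).s - δ) := by
  rw [stage_succ_t, h, stage_succ_s_of_eq_empty h]; simp

/-- For an extension `P` of a kept word, `s - δ < t ≤ q(P)`, so the test for keeping `P` fails. -/
lemma stage_succ_of_gap_lt {n : ℕ} (h : (stage A K a δ n).s - (stage A K a δ n).t < δ) :
    (stage A K a δ (n + 1)).S = ∅ ∧ (stage A K a δ (n + 1)).t = (stage A K a δ n).t ∧
      (stage A K a δ (n + 1)).s = (stage A K a δ n).s := by
  have hS : (stage A K a δ (n + 1)).S = ∅ := by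
    refine Set.eq_empty_of_forall_notMem ?_
    rintro _ ⟨v, hv, i, rfl, hq⟩
    have h1 := stage_t_le_qVal hv
    have h2 := qVal_le_qVal_append (A := A) (K := K) (a := a) (v := v)
      (by rw [length_of_mem_stage hv]; omega) [i]
    linarith
  refine ⟨hS, ?_, stage_succ_s_of_eq_empty hS⟩
  rw [stage_succ_t_of_eq_empty hS, max_eq_left]
  linarith

lemma stage_of_gap_lt {n k : ℕ} (h : (stage A K a δ n).s - (stage A K a δ n).t < δ)
    (hnk : n < k) : (stage A K a δ k).S = ∅ ∧ (stage A K a δ k).t = (stage A K a δ n).t ∧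
      (stage A K a δ k).s = (stage A K a δ n).s := by
  induction k, hnk using Nat.le_induction with
  | base => exact stage_succ_of_gap_lt h
  | succ k _ ih =>
    obtain ⟨-, ht, hs⟩ := ih
    obtain ⟨hS', ht', hs'⟩ := stage_succ_of_gap_lt (A := A) (K := K) (a := a) (δ := δ) (n := k)
      (by rw [ht, hs]; exact h)
    exact ⟨hS', ht'.trans ht, hs'.trans hs⟩

/-- Under the cone condition the set of kept products is eventually empty. -/
lemma eventually_stage_eq_empty (hδ : 0 < δ) (hK : IsInvariantCone K A)
    (hA : AsymptRankOneFamily A) (hH : K ∩ closure (secondarySet A) = {0})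
    (ha : IsPositiveAntinorm K a) {s : ℝ}
    (hs : Tendsto (fun n => (stage A K a δ n).s) atTop (𝓝 s)) :
    ∀ᶠ n in atTop, (stage A K a δ (n + 1)).S = ∅ := by
  obtain ⟨c, hc, hcw⟩ := exists_mul_specRad_le_opAntinorm hK hA hH ha
  have h1 : Tendsto (fun n : ℕ => c ^ ((1 : ℝ) / (n + 2 : ℕ)) * s) atTop (𝓝 s) := by
    have := ((tendsto_const_rpow_one_div hc).comp (tendsto_add_atTop_nat 2)).mul_const s
    rwa [one_mul] at this
  -- The left side tends to `s - δ` and the right side to `s`, so `δ > 0` separates them for large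
  -- `n`.
  filter_upwards [(hs.sub_const δ).eventually_lt h1 (by linarith)] with n hn
  refine Set.eq_empty_of_forall_notMem fun w hw => ?_
  have hl : w.length = n + 2 := length_of_mem_stage hw
  have hq : qVal A K a w < (stage A K a δ n).s - δ := by
    obtain ⟨v, hv, i, rfl, hq⟩ := hw
    exact hq
  have hle : s ≤ specRad (wordProd A w) ^ ((1 : ℝ) / (n + 2 : ℕ)) :=
    (antitone_stage_s.le_of_tendsto hs (n + 1)).trans (stage_s_le hw)
  have h2 := rpow_le_qVal (A := A) (K := K) (a := a) (w := w) (j := n + 2) (by omega) hl.ge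
  rw [List.take_of_length_le hl.le] at h2
  have h3 : c ^ ((1 : ℝ) / (n + 2 : ℕ)) * s ≤
      opAntinorm K a (wordProd A w) ^ ((1 : ℝ) / (n + 2 : ℕ)) :=
    calc _ ≤ c ^ ((1 : ℝ) / (n + 2 : ℕ)) * specRad (wordProd A w) ^ ((1 : ℝ) / (n + 2 : ℕ)) :=
          mul_le_mul_of_nonneg_left hle (Real.rpow_nonneg hc.le _)
      _ = (c * specRad (wordProd A w)) ^ ((1 : ℝ) / (n + 2 : ℕ)) :=
          (Real.mul_rpow hc.le (specRad_nonneg _)).symm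
      _ ≤ _ := Real.rpow_le_rpow (mul_nonneg hc.le (specRad_nonneg _))
          (hcw w (by rintro rfl; simp at hl)) (by positivity)
  linarith

end Stages

end LowerSpectralRadius

/-! ### Assembly of the theorem. -/

open LowerSpectralRadius in
theorem theorem3p1 {d m : ℕ} (hm : 0 < m)
    (A : Fin m → Matrix (Fin d) (Fin d) ℝ) (hA : AsymptRankOneFamily A)
    (K : Set (Fin d → ℝ)) (hK : IsInvariantCone K A)
    (hH : K ∩ closure (secondarySet A) = {0})
    (N : Seminorm ℝ (Fin d → ℝ)) (hN : IsNorm N)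
    (δ : ℝ) (hδ : 0 < δ)
    (a : (Fin d → ℝ) → ℝ) (ha : IsPositiveAntinorm K a) :
    -- the limit that defines the lower spectral radius exists
    Tendsto (minNormRoot N A) atTop (𝓝 (lsr N A)) ∧
    -- the two bounds
    (∀ k, 1 ≤ k → lowerBound A K a δ k ≤ lsr N A ∧ lsr N A ≤ upperBound A K a δ k) ∧
    -- the gap always converges, to a limit that is at most `δ`
    (∃ L ≤ δ, Tendsto (fun k => upperBound A K a δ k - lowerBound A K a δ k) atTop (𝓝 L)) ∧
    -- the limit is exactly `δ` unless the gap drops strictly below `δ` at some step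
    ((∀ k, 1 ≤ k → δ ≤ upperBound A K a δ k - lowerBound A K a δ k) →
      Tendsto (fun k => upperBound A K a δ k - lowerBound A K a δ k) atTop (𝓝 δ)) ∧
    -- and if it does, then the procedure stops at that step
    (∀ n, 1 ≤ n → upperBound A K a δ n - lowerBound A K a δ n < δ →
      ∀ k, n < k → prunedSet A K a δ k = ∅ ∧
        lowerBound A K a δ k = lowerBound A K a δ n ∧
        upperBound A K a δ k = upperBound A K a δ n) := by
  obtain ⟨μ, hμ, hμw⟩ := exists_pow_le_opAntinorm hK hA hH ha
  obtain ⟨c, hc, hcw⟩ := exists_mul_opAntinorm_le_inducedNorm hK ha hN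
  have hlim : Tendsto (minNormRoot N A) atTop (𝓝 (lsr N A)) :=
    tendsto_minNormRoot hm hN hc hμ fun w =>
      (mul_le_mul_of_nonneg_left (hμw w) hc.le).trans (hcw w)
  have hupper : ∀ n, lsr N A ≤ (stage A K a δ n).s :=
    le_stage_s hm fun w hw => lsr_le_specRad hN hlim hw (hA w hw).1
  have hlower : ∀ n, (stage A K a δ n).t ≤ lsr N A :=
    stage_t_le fun β k hβ => le_lsr_of_prefix hm hK hA hH ha hN hlim hβ
  have hs := tendsto_atTop_ciInf (antitone_stage_s (A := A) (K := K) (a := a) (δ := δ))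
    ⟨lsr N A, by rintro _ ⟨n, rfl⟩; exact hupper n⟩
  have ht := tendsto_atTop_ciSup (monotone_stage_t (A := A) (K := K) (a := a) (δ := δ))
    ⟨lsr N A, by rintro _ ⟨n, rfl⟩; exact hlower n⟩
  have hle : (⨅ n, (stage A K a δ n).s) - (⨆ n, (stage A K a δ n).t) ≤ δ := by
    -- With no kept products, the new lower bound is at least the unchanged upper bound minus `δ`,
    -- so the gap is eventually at most `δ`.
    refine le_of_tendsto ((hs.sub ht).comp (tendsto_add_atTop_nat 1)) ?_
    filter_upwards [eventually_stage_eq_empty hδ hK hA hH ha hs] with n hn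
    have h1 := stage_succ_s_of_eq_empty hn
    have h2 := stage_succ_t_of_eq_empty hn
    have h3 := le_max_right (stage A K a δ n).t ((stage A K a δ n).s - δ)
    simp only [Function.comp_apply]
    linarith
  -- Degree `k` is stage `k - 1`; the truncated subtraction affects only `k = 0`, which is
  -- irrelevant to the limit.
  have hgap : Tendsto (fun k => upperBound A K a δ k - lowerBound A K a δ k) atTop
      (𝓝 ((⨅ n, (stage A K a δ n).s) - ⨆ n, (stage A K a δ n).t)) :=
    (hs.sub ht).comp (tendsto_sub_atTop_nat 1)
  refine ⟨hlim, fun k _ => ⟨hlower _, hupper _⟩, ⟨_, hle, hgap⟩, fun h => ?_, ?_⟩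
  · have hge := ge_of_tendsto hgap ((eventually_ge_atTop 1).mono h)
    rwa [le_antisymm hle hge] at hgap
  · intro n hn h k hk
    exact stage_of_gap_lt h (by omega)
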